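/- All graphs are finite and simple. A connected graph is prolific if it is not a path $P_n$ ($n\ge 1$), not a cycle $C_n$ ($n\ge 3$) and not the star $K_{1,3}$. Let $L^0(G)=G$ and let $L^{r+1}(G)=L(L^r(G))$ be the iterated line graphs of $G$. Let $\delta(G)$ be the minimum degree of $G$. The vertex connectivity $\kappa(G)$ is the least size of a vertex set $S$ such that $G-S$ is disconnected or has at most one vertex; the edge connectivity $\lambda(G)$ is the least size of an edge set $T$ such that $G-T$ is disconnected. For a graph parameter $P$ and a family $\mathcal F$ of prolific graphs let $\mathrm{ind}(P,G)=\min\{r : P(G)<P(L^r(G))\}$ and $k(P,\mathcal F)=\sup\{\mathrm{ind}(P,G): G\in\mathcal F\}\in\mathbb N\cup\{\infty\}$; $P$ is called universal over $\mathcal F$ if $k(P,\mathcal F)<\infty$, and non-universal over $\mathcal F$ otherwise. For $1\le k\le d$, the Chartrand–Harary graph $H_{k,d}$ is obtained from two disjoint copies of the complete graph $K_{d+1}$ by adding $k$ pairwise disjoint edges, each joining a vertex of one copy to a vertex of the other. **Theorem.** 1. Every prolific graph $G$ with $\delta(G)\ge 3$ satisfies $\mathrm{ind}(\kappa,G)\le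 2$. 2. For all integers $d\ge 3$ and $1\le k\le d$, the graph $H_{k,d}$ is prolific, has $\kappa(H_{k,d})=\lambda(H_{k,d})=k$ and $\delta(H_{k,d})=d$, and satisfies $\mathrm{ind}(\kappa,H_{k,d})=2$. 3. Hence $k(\kappa,\mathcal F)=2$ for the family $\mathcal F$ of all prolific graphs $G$ with $\delta(G)\ge 3$. 4. Both $\kappa$ and $\lambda$ are non-universal over the family of prolific graphs $G$ with $\delta(G)\le 2$, and also over each of the two families of prolific graphs with $\delta(G)=1$ and with $\delta(G)=2$. -/

import Mathlib

universe u

/-- A finite simple graph, bundled with its vertex type. -/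
structure FinGraph : Type (u + 1) where
  V : Type u
  [finite : Finite V]
  graph : SimpleGraph V

namespace FinGraph

attribute [instance] FinGraph.finite

/-- The line graph `L(G)`. -/
def line (G : FinGraph.{u}) : FinGraph.{u} where
  V := G.graph.edgeSet
  graph := G.graph.lineGraph

/-- The iterated line graph: `L^0(G) = G` and `L^(k+1)(G) = L(L^k(G))`. -/
def iterLine (G : FinGraph.{u}) : ℕ → FinGraph.{u}
  | 0 => G
  | k + 1 => (G.iterLine k).line

/-- A prolific graph: a finite connected graph which is neither a path `P_n` (this includes the
one-vertex graph), nor a cycle `C_n`, nor the star `K_{1,3}`. -/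
def IsProlific (G : FinGraph.{u}) : Prop :=
  G.graph.Connected ∧
    (∀ n : ℕ, IsEmpty (G.graph ≃g SimpleGraph.pathGraph n)) ∧
    (∀ n : ℕ, 3 ≤ n → IsEmpty (G.graph ≃g SimpleGraph.cycleGraph n)) ∧
    IsEmpty (G.graph ≃g completeBipartiteGraph (Fin 1) (Fin 3))

open Classical in
/-- The minimum degree `δ(G)`. -/
noncomputable def minDegree (G : FinGraph.{u}) : ℕ :=
  letI : Fintype G.V := Fintype.ofFinite G.V
  G.graph.minDegree

/-- The vertex connectivity `κ(G)`: the least size of a set `S` of vertices such that `G - S` is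
disconnected or has at most one vertex. -/
noncomputable def vertexConn (G : FinGraph.{u}) : ℕ :=
  sInf {k | ∃ S : Set G.V, S.ncard = k ∧
    (Sᶜ.Subsingleton ∨ ¬ (G.graph.induce Sᶜ).Connected)}

/-- The edge connectivity `λ(G)`: the least size of a set `T` of edges such that `G - T` is
disconnected (and `0` if there is no such set, that is, if `G` has only one vertex). -/
noncomputable def edgeConn (G : FinGraph.{u}) : ℕ :=
  sInf {k | ∃ T : Set (Sym2 G.V), T ⊆ G.graph.edgeSet ∧ T.ncard = k ∧
    ¬ (G.graph.deleteEdges T).Preconnected}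

/-- The index `ind(P, G) = min {r : P(G) < P(L^r(G))}` of `G` for the parameter `P`
(`⊤` if there is no such `r`). -/
noncomputable def ind (P : FinGraph.{u} → ℕ) (G : FinGraph.{u}) : ℕ∞ :=
  ⨅ r ∈ {r : ℕ | P G < P (G.iterLine r)}, (r : ℕ∞)

/-- The index `k(P, F) = max {ind(P, G) : G ∈ F}` of a family `F` of graphs (`⊤` if the indices
of the members of `F` are unbounded). -/
noncomputable def familyIndex (P : FinGraph.{u} → ℕ) (F : Set FinGraph.{u}) : ℕ∞ :=
  ⨆ G ∈ F, ind P G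

/-- `P` is universal over `F` if `k(P, F)` is finite. -/
def IsUniversalOver (P : FinGraph.{u} → ℕ) (F : Set FinGraph.{u}) : Prop :=
  familyIndex P F ≠ ⊤

/-- The Chartrand-Harary graph for connectivities `κ = k`, `λ = l` and minimum degree `d`
(where `1 ≤ k ≤ l ≤ d`): two disjoint complete graphs on the vertices `x_0, …, x_d` and
`y_0, …, y_d`, joined by `l` edges, namely by `x_j y_j` for `j < k` and by `x_0 y_j` for
`k ≤ j < l`. If `k = l` this is a matching of `k` edges between the two complete graphs. -/
def chartrandHarary (k l d : ℕ) : FinGraph.{u} where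
  V := ULift.{u} (Fin (d + 1) ⊕ Fin (d + 1))
  graph := SimpleGraph.fromRel fun v w =>
    match v.down, w.down with
    | .inl _, .inl _ => True
    | .inr _, .inr _ => True
    | .inl i, .inr j => (j : ℕ) < l ∧ (i : ℕ) = if (j : ℕ) < k then (j : ℕ) else 0
    | .inr _, .inl _ => False

end FinGraph

/-! Upper bound. For `δ(G) ≥ 3` the chain is `κ(G) < λ(L(G)) ≤ κ(L²(G))`. The second inequality
holds because a vertex cut of a line graph is an edge cut of the graph below it. For the first,
split `E(G)` into two nonempty classes and let `M` be the set of vertices incident with both. The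
edges at a vertex of `M` form a split clique of `L(G)`, which gives at least `δ - 1 ≥ 2` cut edges,
and cliques of different vertices share no edge. Either `M` separates `G`, so the cut has at least
`2|M| ≥ 2κ > κ` edges, or `M` contains both ends of an edge, so the cut has at least `2(δ - 1) > δ ≥
κ` edges.

Sharpness. In `H_{k,d}` the `k` matching edges form an edge cut with edges on both sides. They are
thus a vertex cut of the line graph, and one step does not raise `κ = k`.

Non-universality. Taking line graphs shortens a path of bridges by only one, and a remaining bridge
keeps `κ` and `λ` at most 1. A long path with a triangle at one end or at both ends therefore has
large index, with `δ = 1` or `δ = 2`. -/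

namespace SimpleGraph

/-! ### Closed vertex sets, cuts and split cliques. -/

variable {V : Type*}

theorem Reachable.mem_of_closed {G : SimpleGraph V} {A : Set V} {u v : V} (h : G.Reachable u v)
    (hA : ∀ x y, G.Adj x y → x ∈ A → y ∈ A) (hu : u ∈ A) : v ∈ A := by
  obtain ⟨p⟩ := h
  induction p with
  | nil => exact hu
  | cons hadj _ ih => exact ih (hA _ _ hadj hu)

theorem not_preconnected_of_closed {G : SimpleGraph V} {A : Set V} {u v : V} (hu : u ∈ A)
    (hv : v ∉ A) (hA : ∀ x y, G.Adj x y → x ∈ A → y ∈ A) : ¬ G.Preconnected :=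
  fun h => hv ((h u v).mem_of_closed hA hu)

theorem exists_closed_of_not_preconnected {G : SimpleGraph V} (h : ¬ G.Preconnected) :
    ∃ A : Set V, ∃ u ∈ A, ∃ v ∉ A, ∀ x y, G.Adj x y → x ∈ A → y ∈ A := by
  simp only [Preconnected, not_forall] at h
  obtain ⟨u, v, huv⟩ := h
  exact ⟨{w | G.Reachable u w}, u, Reachable.refl u, v, huv,
    fun x y hxy hx => Reachable.trans hx hxy.reachable⟩

/-- The set of edges with exactly one end in `A`. -/
def cut (G : SimpleGraph V) (A : Set V) : Set (Sym2 V) :=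
  {e | ∃ u ∈ A, ∃ v ∉ A, G.Adj u v ∧ e = s(u, v)}

theorem cut_subset_edgeSet (G : SimpleGraph V) (A : Set V) : G.cut A ⊆ G.edgeSet := by
  rintro _ ⟨u, -, v, -, h, rfl⟩
  exact h

theorem mk_mem_cut {G : SimpleGraph V} {A : Set V} {u v : V} (h : G.Adj u v) (hu : u ∈ A)
    (hv : v ∉ A) : s(u, v) ∈ G.cut A :=
  ⟨u, hu, v, hv, h, rfl⟩

/-- A clique that is split by `A` contains at least as many edges of the cut of `A` as a star
spanning the clique. -/
theorem IsClique.ncard_le_ncard_cut [Finite V] {G : SimpleGraph V} {K A : Set V}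
    (hK : G.IsClique K) {a b : V} (haK : a ∈ K) (hbK : b ∈ K) (ha : a ∈ A) (hb : b ∉ A) :
    K.ncard ≤ (G.cut A ∩ {e | ∀ x ∈ e, x ∈ K}).ncard + 1 := by
  classical
  have h1 : (K \ {a}).ncard + 1 = K.ncard := Set.ncard_sdiff_singleton_add_one haK
  rw [← h1]
  -- Each `c ≠ a` of the clique is joined to whichever of `a`, `b` lies on the other side. The edge
  -- `s(a, b)` arises from `c = b` alone, as `a` is left out.
  refine Nat.add_le_add_right (Set.ncard_le_ncard_of_injOn
    (fun c => if c ∈ A then s(c, b) else s(a, c)) ?_ ?_) 1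
  · rintro c ⟨hc, hca⟩
    have hca' : a ≠ c := fun h => hca h.symm
    by_cases hcA : c ∈ A
    · simp only [hcA, if_true]
      refine ⟨mk_mem_cut (hK hc hbK ?_) hcA hb, ?_⟩
      · rintro rfl; exact hb hcA
      · simp [hc, hbK]
    · simp only [hcA, if_false]
      refine ⟨mk_mem_cut (hK haK hc hca') ha hcA, ?_⟩
      simp [hc, haK]
  · rintro c ⟨hc, hca⟩ c' ⟨hc', hca'⟩ h
    simp only [Set.mem_singleton_iff] at hca hca'
    by_cases hcA : c ∈ A <;> by_cases hcA' : c' ∈ A <;> simp only [hcA, hcA', if_true, if_false,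
      Sym2.eq_iff] at h <;> grind

end SimpleGraph

/-! ### Minimum degree and the two connectivities. -/

namespace FinGraph

open SimpleGraph

variable {G : FinGraph.{u}}

theorem minDegree_le_ncard (v : G.V) : G.minDegree ≤ (G.graph.neighborSet v).ncard := by
  classical
  let : Fintype G.V := Fintype.ofFinite G.V
  have h := G.graph.minDegree_le_degree v
  rw [← SimpleGraph.card_neighborSet_eq_degree, ← Nat.card_eq_fintype_card,
    Nat.card_coe_set_eq] at h
  unfold minDegree
  convert h

theorem exists_minDegree_eq_ncard [Nonempty G.V] :
    ∃ v, G.minDegree = (G.graph.neighborSet v).ncard := by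
  classical
  let : Fintype G.V := Fintype.ofFinite G.V
  obtain ⟨v, h⟩ := G.graph.exists_minimal_degree_vertex
  refine ⟨v, ?_⟩
  rw [← SimpleGraph.card_neighborSet_eq_degree, ← Nat.card_eq_fintype_card,
    Nat.card_coe_set_eq] at h
  unfold minDegree
  convert h

theorem minDegree_eq {d : ℕ} {v : G.V} (hv : (G.graph.neighborSet v).ncard ≤ d)
    (h : ∀ w, d ≤ (G.graph.neighborSet w).ncard) : G.minDegree = d := by
  have : Nonempty G.V := ⟨v⟩
  obtain ⟨w, hw⟩ := G.exists_minDegree_eq_ncard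
  exact le_antisymm ((minDegree_le_ncard v).trans hv) (hw ▸ h w)

theorem vertexConn_le {S : Set G.V}
    (h : Sᶜ.Subsingleton ∨ ¬ (G.graph.induce Sᶜ).Connected) : G.vertexConn ≤ S.ncard :=
  Nat.sInf_le ⟨S, rfl, h⟩

theorem exists_vertexConn_eq (G : FinGraph.{u}) : ∃ S : Set G.V, S.ncard = G.vertexConn ∧
    (Sᶜ.Subsingleton ∨ ¬ (G.graph.induce Sᶜ).Connected) :=
  by
  refine Nat.sInf_mem (s := {k | ∃ S : Set G.V, S.ncard = k ∧
    (Sᶜ.Subsingleton ∨ ¬ (G.graph.induce Sᶜ).Connected)}) ⟨_, Set.univ, rfl, Or.inl (by simp)⟩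

/-- A vertex set whose removal leaves a set `A` closed under adjacency, with vertices inside and
outside of `A`, bounds the vertex connectivity. -/
theorem vertexConn_le_of_separates {S A : Set G.V} {u v : G.V} (huS : u ∉ S) (hu : u ∈ A)
    (hvS : v ∉ S) (hv : v ∉ A)
    (hA : ∀ x y, G.graph.Adj x y → x ∉ S → y ∉ S → x ∈ A → y ∈ A) : G.vertexConn ≤ S.ncard := by
  refine vertexConn_le (Or.inr fun h => ?_)
  exact not_preconnected_of_closed (A := {x : ↥Sᶜ | (x : G.V) ∈ A}) (u := ⟨u, huS⟩) (v := ⟨v, hvS⟩)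
    hu hv (fun x y hxy hx => hA x y hxy x.2 y.2 hx) h.preconnected

theorem edgeConn_le {T : Set (Sym2 G.V)} (hT : T ⊆ G.graph.edgeSet)
    (h : ¬ (G.graph.deleteEdges T).Preconnected) : G.edgeConn ≤ T.ncard :=
  Nat.sInf_le ⟨T, hT, rfl, h⟩

theorem edgeConn_le_ncard_cut {A : Set G.V} {u v : G.V} (hu : u ∈ A) (hv : v ∉ A) :
    G.edgeConn ≤ (G.graph.cut A).ncard := by
  refine edgeConn_le (cut_subset_edgeSet _ _) (not_preconnected_of_closed hu hv ?_)
  intro x y hxy hx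
  rw [deleteEdges_adj] at hxy
  by_contra hy
  exact hxy.2 (mk_mem_cut hxy.1 hx hy)

/-- A disconnecting edge set contains the whole cut of some component it leaves, so only cuts need
to be bounded. Nontriviality excludes the default value `sInf ∅ = 0`. -/
theorem le_edgeConn [Nontrivial G.V] {k : ℕ}
    (h : ∀ A : Set G.V, ∀ u ∈ A, ∀ v ∉ A, k ≤ (G.graph.cut A).ncard) : k ≤ G.edgeConn := by
  have hne : {k | ∃ T : Set (Sym2 G.V), T ⊆ G.graph.edgeSet ∧ T.ncard = k ∧
      ¬ (G.graph.deleteEdges T).Preconnected}.Nonempty := by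
    obtain ⟨a, b, hab⟩ := exists_pair_ne G.V
    refine ⟨_, G.graph.edgeSet, subset_rfl, rfl,
      not_preconnected_of_closed (A := {a}) rfl (fun h : b = a => hab h.symm) ?_⟩
    intro x y hxy
    rw [deleteEdges_adj] at hxy
    exact absurd hxy.1 hxy.2
  obtain ⟨T, -, hT, hdis⟩ := Nat.sInf_mem hne
  obtain ⟨A, u, hu, v, hv, hA⟩ := exists_closed_of_not_preconnected hdis
  change k ≤ sInf _
  rw [← hT]
  refine (h A u hu v hv).trans (Set.ncard_le_ncard ?_)
  rintro _ ⟨x, hx, y, hy, hxy, rfl⟩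
  by_contra hT
  exact hy (hA x y (deleteEdges_adj.2 ⟨hxy, hT⟩) hx)

theorem one_le_edgeConn [Nontrivial G.V] (h : G.graph.Connected) : 1 ≤ G.edgeConn := by
  refine le_edgeConn fun A u hu v hv => ?_
  rw [Nat.one_le_iff_ne_zero, Ne, Set.ncard_eq_zero]
  intro h0
  refine not_preconnected_of_closed hu hv (fun x y hxy hx => ?_) h.preconnected
  by_contra hy
  exact (h0 ▸ mk_mem_cut hxy hx hy : s(x, y) ∈ (∅ : Set (Sym2 G.V)))

theorem one_le_vertexConn [Nontrivial G.V] (h : G.graph.Connected) : 1 ≤ G.vertexConn := by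
  obtain ⟨S, hS, hsep⟩ := G.exists_vertexConn_eq
  rw [← hS, Nat.one_le_iff_ne_zero, Ne, Set.ncard_eq_zero]
  rintro rfl
  rw [Set.compl_empty] at hsep
  rcases hsep with h1 | h1
  · exact not_subsingleton G.V (Set.subsingleton_univ_iff.1 h1)
  · exact h1 ((induceUnivIso G.graph).connected_iff.2 h)

/-- Deleting the neighbours of a vertex of least degree isolates it or leaves nothing else. -/
theorem vertexConn_le_minDegree [Nonempty G.V] : G.vertexConn ≤ G.minDegree := by
  obtain ⟨v, hv⟩ := G.exists_minDegree_eq_ncard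
  rw [hv]
  by_cases h : ∃ w, w ∉ G.graph.neighborSet v ∧ w ≠ v
  · obtain ⟨w, hw, hwv⟩ := h
    refine vertexConn_le_of_separates (A := {v}) (u := v) (v := w) (by simp) rfl hw hwv ?_
    rintro x y hxy - hy rfl
    exact absurd hxy hy
  · push Not at h
    exact vertexConn_le (Or.inl fun x hx y hy => (h x hx).trans (h y hy).symm)

/-! ### Connectivity of line graphs. -/

/-- An edge of `G`, as a vertex of the line graph. -/
def mkEdge {u v : G.V} (h : G.graph.Adj u v) : G.line.V :=
  (⟨s(u, v), h⟩ : G.graph.edgeSet)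

/-- The pair of ends of a vertex of the line graph. -/
def ends (e : G.line.V) : Sym2 G.V :=
  Subtype.val (p := (· ∈ G.graph.edgeSet)) e

@[simp]
theorem ends_mkEdge {u v : G.V} (h : G.graph.Adj u v) : ends (mkEdge h) = s(u, v) := rfl

theorem ends_injective : Function.Injective (ends (G := G)) := Subtype.val_injective

theorem exists_eq_mkEdge (e : G.line.V) : ∃ u v, ∃ h : G.graph.Adj u v, e = mkEdge h := by
  obtain ⟨e, he⟩ := e
  induction e using Sym2.ind with
  | _ u v => exact ⟨u, v, he, rfl⟩

theorem ends_mem_edgeSet (e : G.line.V) : ends e ∈ G.graph.edgeSet := by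
  obtain ⟨u, v, h, rfl⟩ := exists_eq_mkEdge e
  exact h

theorem line_adj {e f : G.line.V} :
    G.line.graph.Adj e f ↔ e ≠ f ∧ ∃ v, v ∈ ends e ∧ v ∈ ends f :=
  lineGraph_adj_iff_exists

/-- The edge connectivity of a graph is at most the vertex connectivity of its line graph. -/
theorem edgeConn_le_vertexConn_line (hV : 3 ≤ Nat.card G.V) :
    G.edgeConn ≤ G.line.vertexConn := by
  obtain ⟨S, hS, hsep⟩ := G.line.exists_vertexConn_eq
  have hST : ((ends (G := G)) '' S).ncard = S.ncard :=
    Set.ncard_image_of_injective _ ends_injective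
  rw [← hS, ← hST]
  refine edgeConn_le (by rintro _ ⟨e, -, rfl⟩; exact ends_mem_edgeSet e) fun hpre => ?_
  have hadj : ∀ {x y} (h : G.graph.Adj x y), mkEdge h ∉ S →
      (G.graph.deleteEdges ((ends (G := G)) '' S)).Adj x y := by
    intro x y h hn
    rw [deleteEdges_adj]
    refine ⟨h, ?_⟩
    rintro ⟨e, he, hxy⟩
    rw [← ends_mkEdge h] at hxy
    exact hn (ends_injective hxy ▸ he)
  have hadj' : ∀ {x y},
      (G.graph.deleteEdges ((ends (G := G)) '' S)).Adj x y →
      ∃ h : G.graph.Adj x y, mkEdge h ∉ S := by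
    intro x y h
    rw [deleteEdges_adj] at h
    exact ⟨h.1, fun hS => h.2 ⟨_, hS, rfl⟩⟩
  have : Nonempty G.V := (Nat.card_pos_iff.1 (by omega)).1
  -- A connected graph on at least three vertices has at least two edges, so `S` omits more than one
  -- vertex of the line graph.
  have hcard := (Connected.mk hpre).card_vert_le_card_edgeSet_add_one
  have hsub : ¬ Sᶜ.Subsingleton := by
    intro hs
    have : (G.graph.deleteEdges ((ends (G := G)) '' S)).edgeSet
        ⊆ ends '' Sᶜ := by
      intro e he
      induction e using Sym2.ind with
      | _ x y =>
        obtain ⟨h1, h2⟩ := hadj' he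
        exact ⟨_, h2, rfl⟩
    have h1 := Set.ncard_le_ncard this
    have h2 := Set.ncard_image_le (f := (ends (G := G))) (Set.toFinite Sᶜ)
    have h3 := Set.ncard_le_one_iff_subsingleton.2 hs
    rw [Nat.card_coe_set_eq] at hcard
    have h4 := h1.trans h2
    omega
  refine (hsep.resolve_left hsub) ?_
  obtain ⟨e₀, he₀, -⟩ := Set.not_subsingleton_iff.1 hsub
  have : Nonempty ↥Sᶜ := ⟨⟨e₀, he₀⟩⟩
  refine Connected.mk ?_
  by_contra hnp
  obtain ⟨A, e, he, f, hf, hA⟩ := exists_closed_of_not_preconnected hnp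
  have hA' : ∀ g h : ↥Sᶜ, g ∈ A → ∀ x, x ∈ ends (g : G.line.V) → x ∈ ends (h : G.line.V) → h ∈ A := by
    intro g h hg x hxg hxh
    by_cases hgh : g = h
    · exact hgh ▸ hg
    · exact hA g h (line_adj.2 ⟨fun hne => hgh (Subtype.ext hne), x, hxg, hxh⟩) hg
  obtain ⟨x, y, hxy, hexy⟩ := exists_eq_mkEdge (e : G.line.V)
  obtain ⟨z, w, hzw, hfzw⟩ := exists_eq_mkEdge (f : G.line.V)
  -- The vertices touched by `A` are closed under the remaining edges, hence are all vertices; so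
  -- `f` meets an edge of `A` and must itself lie in `A`.
  have key : z ∈ {v | ∃ g ∈ A, v ∈ ends (g : G.line.V)} := by
    refine (hpre x z).mem_of_closed ?_ ⟨e, he, by rw [hexy]; simp⟩
    rintro a b hab ⟨g, hg, ha⟩
    obtain ⟨h1, h2⟩ := hadj' hab
    exact ⟨⟨_, h2⟩, hA' g _ hg a ha (by simp), by simp⟩
  obtain ⟨g, hg, hz⟩ := key
  exact hf (hA' g f hg z hz (by rw [hfzw]; simp))

/-- An edge cut both of whose sides contain edges is a vertex cut of the line graph. -/
theorem vertexConn_line_le_ncard_cut {A : Set G.V} {a b c d : G.V} (hab : G.graph.Adj a b)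
    (hcd : G.graph.Adj c d) (ha : a ∈ A) (hb : b ∈ A) (hc : c ∉ A) (hd : d ∉ A) :
    G.line.vertexConn ≤ (G.graph.cut A).ncard := by
  have hcut : ∀ {x y}, s(x, y) ∈ G.graph.cut A → (x ∈ A ↔ y ∉ A) := by
    rintro x y ⟨u, hu, v, hv, -, h⟩
    rcases Sym2.eq_iff.1 h with ⟨rfl, rfl⟩ | ⟨rfl, rfl⟩ <;> simp [hu, hv]
  have h1 : ({e : G.line.V | ends e ∈ G.graph.cut A}).ncard ≤ (G.graph.cut A).ncard :=
    Set.ncard_le_ncard_of_injOn ends (fun e he => he) ends_injective.injOn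
  refine le_trans ?_ h1
  refine vertexConn_le_of_separates (A := {e : G.line.V | ∃ v ∈ ends e, v ∈ A})
    (u := mkEdge hab) (v := mkEdge hcd) (fun h => (hcut h).1 ha hb) ⟨a, by simp, ha⟩
    (fun h => hc ((hcut h).2 hd)) ?_ ?_
  · rintro ⟨v, hv, hvA⟩
    rcases Sym2.mem_iff.1 hv with rfl | rfl
    exacts [hc hvA, hd hvA]
  · rintro e f hef he - ⟨v, hv, hvA⟩
    obtain ⟨x, y, hxy, rfl⟩ := exists_eq_mkEdge e
    obtain ⟨-, w, hw, hwf⟩ := line_adj.1 hef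
    refine ⟨w, hwf, ?_⟩
    have hx : x ∈ A ↔ y ∈ A := by
      constructor
      · intro hx
        by_contra hy
        exact he (mk_mem_cut hxy hx hy)
      · intro hy
        by_contra hx
        refine he ?_
        change s(x, y) ∈ G.graph.cut A
        rw [Sym2.eq_swap]
        exact mk_mem_cut hxy.symm hy hx
    rcases Sym2.mem_iff.1 hv with rfl | rfl <;> rcases Sym2.mem_iff.1 hw with rfl | rfl <;> tauto

/-- The edges at a vertex, as a set of vertices of the line graph. -/
def edgesAt (G : FinGraph.{u}) (v : G.V) : Set G.line.V := {e | v ∈ ends e}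

theorem isClique_edgesAt (v : G.V) : G.line.graph.IsClique (G.edgesAt v) :=
  fun _ he _ hf hne => line_adj.2 ⟨hne, v, he, hf⟩

theorem minDegree_le_ncard_edgesAt (v : G.V) : G.minDegree ≤ (G.edgesAt v).ncard := by
  refine (minDegree_le_ncard v).trans ?_
  have : (G.graph.neighborSet v).ncard = (Set.univ : Set (G.graph.neighborSet v)).ncard := by
    rw [Set.ncard_univ, Nat.card_coe_set_eq]
  rw [this]
  refine Set.ncard_le_ncard_of_injOn (fun w => mkEdge w.2) ?_ ?_
  · intro w _
    exact Sym2.mem_mk_left _ _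
  · intro w _ w' _ h
    have h := congrArg ends h
    exact Subtype.ext (Sym2.congr_right.1 h)

/-- If `δ(G) ≥ 3`, then the vertex connectivity of `G` is smaller than the edge connectivity of
its line graph. -/
theorem vertexConn_lt_edgeConn_line (hG : G.graph.Connected) (hδ : 3 ≤ G.minDegree) :
    G.vertexConn + 1 ≤ G.line.edgeConn := by
  classical
  have := hG.nonempty
  obtain ⟨v₀⟩ := hG.nonempty
  have hdeg : ∀ v, 3 ≤ (G.edgesAt v).ncard := fun v => hδ.trans (minDegree_le_ncard_edgesAt v)
  have : Nontrivial G.line.V := by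
    obtain ⟨e, -, f, -, h⟩ := (Set.one_lt_ncard_iff_nontrivial.1
      (lt_of_lt_of_le (by norm_num) (hdeg v₀)) : (G.edgesAt v₀).Nontrivial)
    exact ⟨e, f, h⟩
  have : Nontrivial G.V := by
    obtain ⟨e, he⟩ := Set.nonempty_of_ncard_ne_zero
      (fun h => by have := hdeg v₀; omega : (G.edgesAt v₀).ncard ≠ 0)
    obtain ⟨x, y, hxy, -⟩ := exists_eq_mkEdge e
    exact ⟨x, y, hxy.ne⟩
  refine le_edgeConn fun A e₀ he₀ f₀ hf₀ => ?_
  let corner : G.V → Set (Sym2 G.line.V) :=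
    fun v => G.line.graph.cut A ∩ {p | ∀ e ∈ p, e ∈ G.edgesAt v}
  -- The vertices of `G` whose cliques in the line graph are split by `A`.
  let M : Set G.V := {v | (∃ e ∈ A, v ∈ ends e) ∧ ∃ f ∉ A, v ∈ ends f}
  have hcorner : ∀ v ∈ M, G.minDegree ≤ (corner v).ncard + 1 := by
    rintro v ⟨⟨e, he, hve⟩, f, hf, hvf⟩
    exact (minDegree_le_ncard_edgesAt v).trans
      ((isClique_edgesAt v).ncard_le_ncard_cut hve hvf he hf)
  -- Two edges of a simple graph share at most one vertex.
  have hdisj : ∀ v w, v ≠ w → Disjoint (corner v) (corner w) := by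
    intro v w hvw
    rw [Set.disjoint_left]
    rintro p ⟨⟨e, he, f, hf, hef, rfl⟩, hv⟩ ⟨-, hw⟩
    have h1 : ends e = s(v, w) := (Sym2.mem_and_mem_iff hvw).1 ⟨hv e (by simp), hw e (by simp)⟩
    have h2 : ends f = s(v, w) := (Sym2.mem_and_mem_iff hvw).1 ⟨hv f (by simp), hw f (by simp)⟩
    exact hef.ne (ends_injective (h1.trans h2.symm))
  -- Two split cliques suffice: `2(δ - 1) ≥ δ + 1 ≥ κ + 1`, where `δ ≥ 3` is essential.
  have hedge : ∀ u v, u ≠ v → u ∈ M → v ∈ M → G.vertexConn + 1 ≤ (G.line.graph.cut A).ncard := by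
    intro u v huv hu hv
    have h1 := hcorner u hu
    have h2 := hcorner v hv
    have h3 := Set.ncard_union_eq (hdisj u v huv)
    have h4 : (corner u ∪ corner v).ncard ≤ (G.line.graph.cut A).ncard :=
      Set.ncard_le_ncard (Set.union_subset Set.inter_subset_left Set.inter_subset_left)
    have h5 := G.vertexConn_le_minDegree
    omega
  by_cases hv : ∃ v ∉ M, ∃ e ∈ A, v ∈ ends e
  swap
  · push Not at hv
    obtain ⟨x, y, hxy, rfl⟩ := exists_eq_mkEdge e₀
    refine hedge x y hxy.ne ?_ ?_ <;> by_contra h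
    exacts [hv _ h _ he₀ (by simp), hv _ h _ he₀ (by simp)]
  by_cases hw : ∃ v ∉ M, ∃ e ∉ A, v ∈ ends e
  swap
  · push Not at hw
    obtain ⟨x, y, hxy, rfl⟩ := exists_eq_mkEdge f₀
    refine hedge x y hxy.ne ?_ ?_ <;> by_contra h
    exacts [hw _ h _ hf₀ (by simp), hw _ h _ hf₀ (by simp)]
  obtain ⟨v, hvM, e, he, hve⟩ := hv
  obtain ⟨w, hwM, f, hf, hwf⟩ := hw
  -- Outside `M` each vertex sees one class only, so no edge avoiding `M` leads from a vertex of
  -- class `A` to one of the other class.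
  have hκ : G.vertexConn ≤ M.ncard := by
    refine vertexConn_le_of_separates (A := {x | ∃ e ∈ A, x ∈ ends e}) hvM ⟨e, he, hve⟩ hwM
      (fun h => hwM ⟨h, f, hf, hwf⟩) ?_
    intro x y hxy hxM hyM hx
    refine ⟨mkEdge hxy, ?_, by simp⟩
    by_contra hn
    exact hxM ⟨hx, _, hn, by simp⟩
  have h1 : M.toFinite.toFinset.card • 2 ≤
      (M.toFinite.toFinset.biUnion fun v => (corner v).toFinite.toFinset).card := by
    rw [Finset.card_biUnion]
    · refine Finset.card_nsmul_le_sum _ _ _ fun v hv => ?_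
      rw [← Set.ncard_eq_toFinset_card]
      have := hcorner v (by simpa using hv)
      omega
    · intro x _ y _ hxy
      simpa using hdisj x y hxy
  have h2 : (M.toFinite.toFinset.biUnion fun v => (corner v).toFinite.toFinset).card ≤
      (G.line.graph.cut A).ncard := by
    rw [Set.ncard_eq_toFinset_card _ (Set.toFinite _)]
    refine Finset.card_le_card ?_
    intro p hp
    simp only [Finset.mem_biUnion, Set.Finite.mem_toFinset] at hp ⊢
    obtain ⟨v, -, hv⟩ := hp
    exact hv.1
  rw [← Set.ncard_eq_toFinset_card] at h1
  -- Now the cut has at least `2κ` edges, and `κ ≥ 1` makes this at least `κ + 1`.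
  have h3 := one_le_vertexConn hG
  simp only [smul_eq_mul] at h1
  omega

/-! ### Bounds for the index and a criterion for being prolific. -/

theorem ind_le {P : FinGraph.{u} → ℕ} {r : ℕ} (h : P G < P (G.iterLine r)) : ind P G ≤ r :=
  iInf₂_le (f := fun (r : ℕ) (_ : r ∈ {r : ℕ | P G < P (G.iterLine r)}) => (r : ℕ∞)) r h

theorem le_ind {P : FinGraph.{u} → ℕ} {n : ℕ} (h : ∀ r < n, P (G.iterLine r) ≤ P G) :
    (n : ℕ∞) ≤ ind P G := by
  refine le_iInf₂ fun r hr => ?_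
  by_contra hlt
  exact absurd (h r (by exact_mod_cast not_le.1 hlt)) (not_le.2 hr)

theorem ind_vertexConn_le_two (hG : G.graph.Connected) (hδ : 3 ≤ G.minDegree) :
    ind vertexConn G ≤ 2 := by
  refine ind_le (r := 2) (lt_of_lt_of_le (vertexConn_lt_edgeConn_line hG hδ)
    (edgeConn_le_vertexConn_line ?_))
  obtain ⟨v₀⟩ := hG.nonempty
  calc 3 ≤ (G.edgesAt v₀).ncard := hδ.trans (minDegree_le_ncard_edgesAt v₀)
    _ ≤ Nat.card G.line.V := by
      rw [← Set.ncard_univ]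
      exact Set.ncard_le_ncard (Set.subset_univ _)

/-- Three neighbours of one vertex exclude paths and cycles; the order excludes the star. -/
theorem isProlific_of_three_le_ncard (hG : G.graph.Connected) {v : G.V}
    (hv : 3 ≤ (G.graph.neighborSet v).ncard) (hV : Nat.card G.V ≠ 4) : G.IsProlific := by
  obtain ⟨a, b, c, ha, hb, hc, hab, hac, hbc⟩ := (Set.two_lt_ncard_iff (Set.toFinite _)).1 hv
  refine ⟨hG, fun n => ⟨fun φ => ?_⟩, fun n hn => ⟨fun φ => ?_⟩, ⟨fun φ => hV ?_⟩⟩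
  · have ha' := φ.map_adj_iff.2 ha
    have hb' := φ.map_adj_iff.2 hb
    have hc' := φ.map_adj_iff.2 hc
    rw [pathGraph_adj] at ha' hb' hc'
    have hab' := Fin.val_ne_of_ne (φ.injective.ne hab)
    have hac' := Fin.val_ne_of_ne (φ.injective.ne hac)
    have hbc' := Fin.val_ne_of_ne (φ.injective.ne hbc)
    omega
  · obtain ⟨n, rfl⟩ := Nat.exists_eq_add_of_le' (by omega : 2 ≤ n)
    have ha' := φ.map_adj_iff.2 ha
    have hb' := φ.map_adj_iff.2 hb
    have hc' := φ.map_adj_iff.2 hc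
    rw [cycleGraph_adj] at ha' hb' hc'
    have hab' := φ.injective.ne hab
    have hac' := φ.injective.ne hac
    have hbc' := φ.injective.ne hbc
    grind
  · rw [Nat.card_congr φ.toEquiv]
    simp

end FinGraph

/-! ### Chartrand–Harary graphs. -/

namespace FinGraph

open SimpleGraph

variable {G : FinGraph.{u}}

section ChartrandHarary

variable {k d : ℕ}

/-- The vertex `x_i` of a Chartrand-Harary graph. -/
def chLeft (k d : ℕ) (i : Fin (d + 1)) : (chartrandHarary.{u} k k d).V := ULift.up (Sum.inl i)

/-- The vertex `y_i` of a Chartrand-Harary graph. -/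
def chRight (k d : ℕ) (i : Fin (d + 1)) : (chartrandHarary.{u} k k d).V := ULift.up (Sum.inr i)

theorem chLeft_injective : Function.Injective (chLeft.{u} k d) :=
  ULift.up_injective.comp Sum.inl_injective

theorem chRight_injective : Function.Injective (chRight.{u} k d) :=
  ULift.up_injective.comp Sum.inr_injective

theorem chLeft_ne_chRight (i j : Fin (d + 1)) : chLeft.{u} k d i ≠ chRight k d j :=
  fun h => Sum.inl_ne_inr (ULift.up_injective h)

theorem eq_chLeft_or_eq_chRight (v : (chartrandHarary.{u} k k d).V) :
    (∃ i, v = chLeft k d i) ∨ ∃ i, v = chRight k d i := by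
  obtain ⟨i | i⟩ := v
  exacts [Or.inl ⟨i, rfl⟩, Or.inr ⟨i, rfl⟩]

theorem chartrandHarary_adj {v w : (chartrandHarary.{u} k k d).V} :
    (chartrandHarary.{u} k k d).graph.Adj v w ↔
      (∃ i j, i ≠ j ∧ v = chLeft k d i ∧ w = chLeft k d j) ∨
      (∃ i j, i ≠ j ∧ v = chRight k d i ∧ w = chRight k d j) ∨
      (∃ i : Fin (d + 1), (i : ℕ) < k ∧ v = chLeft k d i ∧ w = chRight k d i) ∨
      ∃ i : Fin (d + 1), (i : ℕ) < k ∧ v = chRight k d i ∧ w = chLeft k d i := by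
  obtain ⟨i | i⟩ := v <;> obtain ⟨j | j⟩ := w <;>
    simp [chartrandHarary, chLeft, chRight, fromRel_adj] <;> grind

theorem chLeft_adj_chLeft {i j : Fin (d + 1)} (h : i ≠ j) :
    (chartrandHarary.{u} k k d).graph.Adj (chLeft k d i) (chLeft k d j) :=
  chartrandHarary_adj.2 (Or.inl ⟨i, j, h, rfl, rfl⟩)

theorem chRight_adj_chRight {i j : Fin (d + 1)} (h : i ≠ j) :
    (chartrandHarary.{u} k k d).graph.Adj (chRight k d i) (chRight k d j) :=
  chartrandHarary_adj.2 (Or.inr (Or.inl ⟨i, j, h, rfl, rfl⟩))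

theorem chLeft_adj_chRight {i : Fin (d + 1)} (h : (i : ℕ) < k) :
    (chartrandHarary.{u} k k d).graph.Adj (chLeft k d i) (chRight k d i) :=
  chartrandHarary_adj.2 (Or.inr (Or.inr (Or.inl ⟨i, h, rfl, rfl⟩)))

/-- The `k` pairs `{x_j, y_j}` are disjoint, so some pair avoids `S`; every other surviving vertex
is adjacent to the member of that pair in its own clique. -/
theorem connected_induce_of_ncard_lt {S : Set (chartrandHarary.{u} k k d).V} (hkd : k ≤ d)
    (hS : S.ncard < k) : ((chartrandHarary.{u} k k d).graph.induce Sᶜ).Connected := by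
  obtain ⟨j, hj, hl, hr⟩ : ∃ j : Fin (d + 1), (j : ℕ) < k ∧ chLeft k d j ∉ S ∧
      chRight k d j ∉ S := by
    by_contra hcon
    have hex : ∀ j : Fin k, ∃ v ∈ S, v = chLeft k d (j.castLE (by omega)) ∨
        v = chRight k d (j.castLE (by omega)) := by
      intro j
      by_contra h
      push Not at h
      exact hcon ⟨j.castLE (by omega), j.2, fun h' => (h _ h').1 rfl, fun h' => (h _ h').2 rfl⟩
    choose f hf hfv using hex
    have hinj : Function.Injective f := by
      intro a b hab
      have h1 := hfv a
      rw [hab] at h1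
      have key : (a.castLE (by omega) : Fin (d + 1)) = b.castLE (by omega) := by
        rcases h1 with h1 | h1 <;> rcases hfv b with h2 | h2 <;> rw [h1] at h2
        · exact chLeft_injective h2
        · exact absurd h2 (chLeft_ne_chRight _ _)
        · exact absurd h2.symm (chLeft_ne_chRight _ _)
        · exact chRight_injective h2
      exact Fin.castLE_injective _ key
    have h3 := Set.ncard_le_ncard_of_injOn (s := Set.univ) (t := S) f (fun a _ => hf a) hinj.injOn
    rw [Set.ncard_univ, Nat.card_eq_fintype_card, Fintype.card_fin] at h3
    omega
  have hlr : ((chartrandHarary.{u} k k d).graph.induce Sᶜ).Reachable ⟨_, hl⟩ ⟨_, hr⟩ :=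
    Adj.reachable (chLeft_adj_chRight hj : (chartrandHarary.{u} k k d).graph.Adj _ _)
  rw [connected_iff_exists_forall_reachable]
  refine ⟨⟨_, hl⟩, fun ⟨w, hw⟩ => ?_⟩
  rcases eq_chLeft_or_eq_chRight w with ⟨i, rfl⟩ | ⟨i, rfl⟩ <;> rcases eq_or_ne j i with rfl | hi
  · exact Reachable.refl _
  · exact Adj.reachable (chLeft_adj_chLeft hi : (chartrandHarary.{u} k k d).graph.Adj _ _)
  · exact hlr
  · exact hlr.trans
      (Adj.reachable (chRight_adj_chRight hi : (chartrandHarary.{u} k k d).graph.Adj _ _))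

theorem chartrandHarary_connected (hk : 1 ≤ k) (hkd : k ≤ d) :
    (chartrandHarary.{u} k k d).graph.Connected := by
  have h := connected_induce_of_ncard_lt.{u} (S := ∅) hkd (by rwa [Set.ncard_empty])
  rw [Set.compl_empty] at h
  exact (induceUnivIso _).connected_iff.1 h

theorem ncard_cut_range_chLeft_le (hkd : k ≤ d) :
    ((chartrandHarary.{u} k k d).graph.cut (Set.range (chLeft k d))).ncard ≤ k := by
  have hsub : (chartrandHarary.{u} k k d).graph.cut (Set.range (chLeft k d)) ⊆
      (fun j : Fin k => s(chLeft k d (j.castLE (by omega)), chRight k d (j.castLE (by omega)))) ''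
        Set.univ := by
    rintro _ ⟨_, ⟨i, rfl⟩, w, hw, h, rfl⟩
    rcases chartrandHarary_adj.1 h with ⟨a, b, -, -, rfl⟩ | ⟨a, b, -, h1, -⟩ | ⟨a, ha, h1, rfl⟩ |
      ⟨a, -, h1, -⟩
    · exact absurd ⟨b, rfl⟩ hw
    · exact absurd h1 (chLeft_ne_chRight _ _)
    · exact ⟨⟨a, ha⟩, trivial, by rw [h1]; rfl⟩
    · exact absurd h1 (chLeft_ne_chRight _ _)
  refine (Set.ncard_le_ncard hsub).trans ((Set.ncard_image_le Set.finite_univ).trans ?_)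
  simp [Set.ncard_univ]

theorem ncard_range_fin {α : Type*} {n : ℕ} {f : Fin n → α} (hf : Function.Injective f) :
    (Set.range f).ncard = n := by
  rw [← Set.image_univ, Set.ncard_image_of_injective _ hf, Set.ncard_univ,
    Nat.card_eq_fintype_card, Fintype.card_fin]

/-- A cut either splits one of the cliques, at a cost of at least `d ≥ k` edges, or separates the
two cliques and contains the whole matching. -/
theorem le_edgeConn_chartrandHarary (hkd : k ≤ d) :
    k ≤ (chartrandHarary.{u} k k d).edgeConn := by
  have : Nontrivial (chartrandHarary.{u} k k d).V :=
    ⟨chLeft k d 0, chRight k d 0, chLeft_ne_chRight _ _⟩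
  refine le_edgeConn fun A u hu v hv => ?_
  have hclique : ∀ f : Fin (d + 1) → (chartrandHarary.{u} k k d).V, Function.Injective f →
      (∀ i j, i ≠ j → (chartrandHarary.{u} k k d).graph.Adj (f i) (f j)) → ∀ i j, f i ∈ A →
      f j ∉ A → k ≤ ((chartrandHarary.{u} k k d).graph.cut A).ncard := by
    intro f hf hadj i j hi hj
    have hK : (chartrandHarary.{u} k k d).graph.IsClique (Set.range f) := by
      rintro _ ⟨a, rfl⟩ _ ⟨b, rfl⟩ hab
      exact hadj a b fun h => hab (h ▸ rfl)
    have h1 := hK.ncard_le_ncard_cut ⟨i, rfl⟩ ⟨j, rfl⟩ hi hj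
    rw [ncard_range_fin hf] at h1
    exact hkd.trans ((Nat.le_of_succ_le_succ h1).trans (Set.ncard_le_ncard Set.inter_subset_left))
  by_cases hl : ∃ i j, chLeft k d i ∈ A ∧ chLeft k d j ∉ A
  · obtain ⟨i, j, hi, hj⟩ := hl
    exact hclique _ chLeft_injective (fun _ _ => chLeft_adj_chLeft) i j hi hj
  by_cases hr : ∃ i j, chRight k d i ∈ A ∧ chRight k d j ∉ A
  · obtain ⟨i, j, hi, hj⟩ := hr
    exact hclique _ chRight_injective (fun _ _ => chRight_adj_chRight) i j hi hj
  have hmatch : ∀ i : Fin (d + 1), ¬ (chLeft k d i ∈ A ↔ chRight k d i ∈ A) := by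
    intro i hi
    push Not at hl hr
    rcases eq_chLeft_or_eq_chRight u with ⟨a, rfl⟩ | ⟨a, rfl⟩ <;>
    rcases eq_chLeft_or_eq_chRight v with ⟨b, rfl⟩ | ⟨b, rfl⟩
    · exact hv (hl _ _ hu)
    · exact hv (hr _ _ (hi.1 (hl _ _ hu)))
    · exact hv (hl _ _ (hi.2 (hr _ _ hu)))
    · exact hv (hr _ _ hu)
  have h1 := Set.ncard_le_ncard_of_injOn (s := Set.univ)
    (t := (chartrandHarary.{u} k k d).graph.cut A)
    (fun j : Fin k => s(chLeft k d (j.castLE (by omega)), chRight k d (j.castLE (by omega)))) ?_ ?_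
  · rwa [Set.ncard_univ, Nat.card_eq_fintype_card, Fintype.card_fin] at h1
  · intro j _
    have hj := hmatch (j.castLE (by omega))
    have hadj := chLeft_adj_chRight.{u} (k := k) (i := j.castLE (by omega : k ≤ d + 1)) j.2
    by_cases h : chLeft k d (j.castLE (by omega)) ∈ A
    · exact mk_mem_cut hadj h fun h' => hj (iff_of_true h h')
    · rw [Sym2.eq_swap]
      exact mk_mem_cut hadj.symm (by tauto) h
  · intro a _ b _ hab
    rcases Sym2.eq_iff.1 hab with h | h
    · exact Fin.castLE_injective _ (chLeft_injective h.1)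
    · exact absurd h.1 (chLeft_ne_chRight _ _)

theorem edgeConn_chartrandHarary (hkd : k ≤ d) : (chartrandHarary.{u} k k d).edgeConn = k := by
  refine le_antisymm ?_ (le_edgeConn_chartrandHarary hkd)
  refine le_trans (edgeConn_le_ncard_cut (u := chLeft k d 0) (v := chRight k d 0)
    (Set.mem_range_self 0) ?_) (ncard_cut_range_chLeft_le hkd)
  rintro ⟨i, hi⟩
  exact chLeft_ne_chRight _ _ hi

theorem vertexConn_chartrandHarary (hkd : k ≤ d) :
    (chartrandHarary.{u} k k d).vertexConn = k := by
  apply le_antisymm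
  · have hinj : Function.Injective fun j : Fin k => chLeft.{u} k d (j.castLE (by omega)) :=
      chLeft_injective.comp (Fin.castLE_injective _)
    refine le_trans ?_ (ncard_range_fin hinj).le
    -- The matched vertices `x_0, …, x_{k-1}` are removed; `x_d` survives because `k ≤ d`.
    refine vertexConn_le_of_separates (A := Set.range (chLeft k d)) (u := chLeft k d (Fin.last d))
      (v := chRight k d 0) ?_ ⟨_, rfl⟩ ?_ ?_ ?_
    · rintro ⟨j, hj⟩
      have := congrArg Fin.val (chLeft_injective hj)
      rw [Fin.val_castLE, Fin.val_last] at this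
      omega
    · rintro ⟨j, hj⟩
      exact chLeft_ne_chRight _ _ hj
    · rintro ⟨j, hj⟩
      exact chLeft_ne_chRight _ _ hj
    · rintro _ w h hS - ⟨i, rfl⟩
      rcases chartrandHarary_adj.1 h with ⟨a, b, -, -, rfl⟩ | ⟨a, b, -, h1, -⟩ |
        ⟨a, ha, h1, rfl⟩ | ⟨a, -, h1, -⟩
      · exact ⟨b, rfl⟩
      · exact absurd h1 (chLeft_ne_chRight _ _)
      · exact absurd ⟨⟨a, ha⟩, h1.symm⟩ hS
      · exact absurd h1 (chLeft_ne_chRight _ _)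
  · obtain ⟨S, hS, hsep⟩ := (chartrandHarary.{u} k k d).exists_vertexConn_eq
    by_contra hlt
    rw [← hS, not_le] at hlt
    rcases hsep with h | h
    · have h1 := Set.ncard_add_ncard_compl S
      have h2 := Set.ncard_le_one_iff_subsingleton.2 h
      have h3 : Nat.card (chartrandHarary.{u} k k d).V = (d + 1) + (d + 1) := by
        simp [chartrandHarary]
      omega
    · exact h (connected_induce_of_ncard_lt hkd hlt)

theorem le_ncard_neighborSet_chartrandHarary (v : (chartrandHarary.{u} k k d).V) :
    d ≤ ((chartrandHarary.{u} k k d).graph.neighborSet v).ncard := by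
  have key : ∀ f : Fin (d + 1) → (chartrandHarary.{u} k k d).V, Function.Injective f →
      (∀ i j, i ≠ j → (chartrandHarary.{u} k k d).graph.Adj (f i) (f j)) → ∀ i,
      d ≤ ((chartrandHarary.{u} k k d).graph.neighborSet (f i)).ncard := by
    intro f hf hadj i
    have h1 : f '' {i}ᶜ ⊆ (chartrandHarary.{u} k k d).graph.neighborSet (f i) := by
      rintro _ ⟨j, hj, rfl⟩
      exact hadj i j fun h => hj h.symm
    have h2 := Set.ncard_le_ncard h1
    have h3 := Set.ncard_add_ncard_compl ({i} : Set (Fin (d + 1)))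
    rw [Set.ncard_image_of_injective _ hf] at h2
    rw [Set.ncard_singleton, Nat.card_eq_fintype_card, Fintype.card_fin] at h3
    omega
  rcases eq_chLeft_or_eq_chRight v with ⟨i, rfl⟩ | ⟨i, rfl⟩
  · exact key _ chLeft_injective (fun _ _ => chLeft_adj_chLeft) i
  · exact key _ chRight_injective (fun _ _ => chRight_adj_chRight) i

theorem minDegree_chartrandHarary (hkd : k ≤ d) : (chartrandHarary.{u} k k d).minDegree = d := by
  refine minDegree_eq (v := chLeft k d (Fin.last d)) ?_ le_ncard_neighborSet_chartrandHarary
  have h1 : (chartrandHarary.{u} k k d).graph.neighborSet (chLeft k d (Fin.last d)) ⊆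
      chLeft k d '' {Fin.last d}ᶜ := by
    intro w h
    rcases chartrandHarary_adj.1 h with ⟨a, b, hab, h1, rfl⟩ | ⟨a, b, -, h1, -⟩ |
        ⟨a, ha, h1, rfl⟩ | ⟨a, -, h1, -⟩
    · exact ⟨b, fun hb => hab ((chLeft_injective h1).symm.trans hb.symm), rfl⟩
    · exact absurd h1 (chLeft_ne_chRight _ _)
    · rw [← chLeft_injective h1, Fin.val_last] at ha
      omega
    · exact absurd h1 (chLeft_ne_chRight _ _)
  have h2 := Set.ncard_le_ncard h1
  have h3 := Set.ncard_add_ncard_compl ({Fin.last d} : Set (Fin (d + 1)))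
  rw [Set.ncard_image_of_injective _ chLeft_injective] at h2
  rw [Set.ncard_singleton, Nat.card_eq_fintype_card, Fintype.card_fin] at h3
  omega

theorem isProlific_chartrandHarary (hk : 1 ≤ k) (hkd : k ≤ d) (hd : 3 ≤ d) :
    (chartrandHarary.{u} k k d).IsProlific := by
  refine isProlific_of_three_le_ncard (chartrandHarary_connected hk hkd) (v := chLeft k d 0)
    (hd.trans (le_ncard_neighborSet_chartrandHarary _)) ?_
  have : Nat.card (chartrandHarary.{u} k k d).V = (d + 1) + (d + 1) := by
    simp [chartrandHarary]
  omega

/-- The matching cuts the graph into two sides that both contain edges, so it is a vertex cut of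
size at most `k` in the line graph. -/
theorem ind_vertexConn_chartrandHarary (hk : 1 ≤ k) (hkd : k ≤ d) (hd : 3 ≤ d) :
    ind vertexConn (chartrandHarary.{u} k k d) = 2 := by
  refine le_antisymm (ind_vertexConn_le_two (chartrandHarary_connected hk hkd)
    (hd.trans (minDegree_chartrandHarary hkd).ge)) (le_ind (n := 2) fun r hr => ?_)
  interval_cases r
  · exact le_rfl
  · rw [vertexConn_chartrandHarary hkd]
    have h01 : (0 : Fin (d + 1)) ≠ Fin.last d := by
      intro h
      have := congrArg Fin.val h
      simp at this
      omega
    have hr : ∀ i, chRight.{u} k d i ∉ Set.range (chLeft k d) := by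
      rintro i ⟨j, hj⟩
      exact chLeft_ne_chRight _ _ hj
    exact (vertexConn_line_le_ncard_cut (chLeft_adj_chLeft h01) (chRight_adj_chRight h01)
      (Set.mem_range_self _) (Set.mem_range_self _) (hr _) (hr _)).trans (ncard_cut_range_chLeft_le hkd)

end ChartrandHarary

end FinGraph

/-! ### Paths of bridges and their behaviour under line graphs. -/

namespace FinGraph

open SimpleGraph

variable {G : FinGraph.{u}}

/-- `G` has a level function with values in `{0, …, n}` for which adjacent vertices lie on equal or
consecutive levels, consecutive levels are joined by exactly one edge, and each intermediate level
has at most one vertex. The edges joining consecutive levels form a path of `n` bridges whose inner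
vertices have degree two. -/
def HasBridgePath (n : ℕ) (G : FinGraph.{u}) : Prop :=
  ∃ f : G.V → ℕ, (∀ u v, G.graph.Adj u v → f u ≤ f v + 1) ∧
    (∀ u v, 0 < f u → f u < n → f u = f v → u = v) ∧
    (∀ i < n, ∃ u v, G.graph.Adj u v ∧ f u = i ∧ f v = i + 1) ∧
    ∀ i < n, ∀ u v u' v', G.graph.Adj u v → G.graph.Adj u' v' → f u = i → f v = i + 1 →
      f u' = i → f v' = i + 1 → u = u' ∧ v = v'

theorem HasBridgePath.edgeConn_le_one {n : ℕ} (h : HasBridgePath (n + 1) G) :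
    G.edgeConn ≤ 1 := by
  obtain ⟨f, hf, -, hex, huniq⟩ := h
  obtain ⟨u, v, huv, hu, hv⟩ := hex 0 (by omega)
  refine (edgeConn_le_ncard_cut (A := {x | f x = 0}) (u := u) (v := v) hu (by simp [hv])).trans ?_
  rw [← Set.ncard_singleton s(u, v)]
  refine Set.ncard_le_ncard ?_
  rintro _ ⟨x, hx, y, hy, hxy, rfl⟩
  have h1 := hf y x hxy.symm
  have hx' : f x = 0 := hx
  have hy' : f y ≠ 0 := hy
  obtain ⟨rfl, rfl⟩ := huniq 0 (by omega) x y u v hxy huv hx (by omega) hu hv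
  rfl

/-- An end of the first bridge is a cut vertex if its side has a further vertex; otherwise the graph
is a single edge. -/
theorem HasBridgePath.vertexConn_le_one {n : ℕ} (h : HasBridgePath (n + 1) G) :
    G.vertexConn ≤ 1 := by
  obtain ⟨f, hf, -, hex, huniq⟩ := h
  obtain ⟨u, v, huv, hu, hv⟩ := hex 0 (by omega)
  have hcross : ∀ x y, G.graph.Adj x y → f x = 0 → f y ≠ 0 → x = u ∧ y = v := by
    intro x y hxy hx hy
    have h1 := hf y x hxy.symm
    exact huniq 0 (by omega) x y u v hxy huv hx (by omega) hu hv
  by_cases h1 : ∃ w, w ≠ u ∧ f w = 0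
  · obtain ⟨w, hwu, hw⟩ := h1
    rw [← Set.ncard_singleton u]
    refine vertexConn_le_of_separates (A := {x | f x = 0}) (u := w) (v := v) hwu hw huv.ne'
      (by simp [hv]) fun x y hxy hxu _ hx => ?_
    by_contra hy
    exact hxu (hcross x y hxy hx hy).1
  by_cases h2 : ∃ w, w ≠ v ∧ f w ≠ 0
  · obtain ⟨w, hwv, hw⟩ := h2
    rw [← Set.ncard_singleton v]
    refine vertexConn_le_of_separates (A := {x | f x = 0}) (u := u) (v := w) huv.ne hu hwv
      hw fun x y hxy _ hyv hx => ?_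
    by_contra hy
    exact hyv (hcross x y hxy hx hy).2
  rw [← Set.ncard_singleton u]
  push Not at h1 h2
  have h3 : ∀ x, x ≠ u → x = v := fun x hx => by
    by_contra hxv
    exact h1 x hx (h2 x hxv)
  exact vertexConn_le (Or.inl fun x hx y hy => (h3 x hx).trans (h3 y hy).symm)

theorem mkEdge_symm {u v : G.V} (h : G.graph.Adj u v) : mkEdge h.symm = mkEdge h :=
  ends_injective Sym2.eq_swap

theorem exists_eq_mkEdge_of_le (f : G.V → ℕ) (e : G.line.V) :
    ∃ u v, ∃ h : G.graph.Adj u v, e = mkEdge h ∧ f u ≤ f v := by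
  obtain ⟨u, v, h, rfl⟩ := exists_eq_mkEdge e
  rcases le_total (f u) (f v) with huv | huv
  exacts [⟨u, v, h, rfl, huv⟩, ⟨v, u, h.symm, (mkEdge_symm h).symm, huv⟩]

/-- The line graph of a graph with a path of `n + 1` bridges has a path of `n` bridges. -/
theorem HasBridgePath.line {n : ℕ} (h : HasBridgePath (n + 1) G) : HasBridgePath n G.line := by
  obtain ⟨f, hf, hsing, hex, huniq⟩ := h
  -- An edge receives the lower level of its ends. The truncation at `n` puts the last bridge and
  -- everything beyond it on the final level.
  let g : G.line.V → ℕ := fun e =>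
    Sym2.lift ⟨fun u v => min (min (f u) (f v)) n, fun u v => by simp only [min_comm (f u)]⟩ (ends e)
  have hg : ∀ {u v} (h : G.graph.Adj u v), g (mkEdge h) = min (min (f u) (f v)) n :=
    fun h => rfl
  -- An intermediate level is a single vertex, so no edge stays inside it.
  have hstep : ∀ {u v} (h : G.graph.Adj u v), f u ≤ f v → 0 < f u → f u < n + 1 →
      f v = f u + 1 := by
    intro u v h huv h0 hn
    have h1 := hf v u h.symm
    by_contra hne
    exact h.ne (hsing u v h0 hn (by omega))
  refine ⟨g, ?_, ?_, ?_, ?_⟩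
  · intro e e' hee'
    obtain ⟨-, w, hw, hw'⟩ := line_adj.1 hee'
    obtain ⟨x, y, hxy, rfl⟩ := exists_eq_mkEdge e
    obtain ⟨x', y', hxy', rfl⟩ := exists_eq_mkEdge e'
    rw [hg, hg]
    have h1 := hf x' y' hxy'
    have h2 := hf y' x' hxy'.symm
    rcases Sym2.mem_iff.1 hw with rfl | rfl <;> rcases Sym2.mem_iff.1 hw' with rfl | rfl <;> omega
  · intro e e' h0 hn hee'
    obtain ⟨x, y, hxy, rfl, hle⟩ := exists_eq_mkEdge_of_le f e
    obtain ⟨x', y', hxy', rfl, hle'⟩ := exists_eq_mkEdge_of_le f e'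
    rw [hg] at h0 hn
    rw [hg, hg] at hee'
    have h1 := hstep hxy hle (by omega) (by omega)
    have h2 := hstep hxy' hle' (by omega) (by omega)
    obtain ⟨rfl, rfl⟩ := huniq (f x) (by omega) x y x' y' hxy hxy' rfl h1 (by omega) (by omega)
    rfl
  · intro i hi
    obtain ⟨a, b, hab, ha, hb⟩ := hex i (by omega)
    obtain ⟨b', c, hbc, hb', hc⟩ := hex (i + 1) (by omega)
    obtain rfl := hsing b b' (by omega) (by omega) (by omega)
    refine ⟨mkEdge hab, mkEdge hbc, line_adj.2 ⟨fun he => ?_, b, by simp, by simp⟩, ?_, ?_⟩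
    · have he := congrArg g he
      rw [hg, hg] at he
      omega
    · rw [hg]; omega
    · rw [hg]; omega
  -- Adjacent edges on levels `i` and `i + 1` form a path `x y z` through two consecutive bridges,
  -- which are unique in `G`.
  · have key : ∀ i < n, ∀ e e', G.line.graph.Adj e e' → g e = i → g e' = i + 1 →
        ∃ x y z, ∃ (hxy : G.graph.Adj x y) (hyz : G.graph.Adj y z), e = mkEdge hxy ∧
          e' = mkEdge hyz ∧ f x = i ∧ f y = i + 1 ∧ f z = i + 2 := by
      intro i hi e e' hee' he he'
      obtain ⟨-, w, hw, hw'⟩ := line_adj.1 hee'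
      obtain ⟨x, y, hxy, rfl, hle⟩ := exists_eq_mkEdge_of_le f e
      obtain ⟨x', y', hxy', rfl, hle'⟩ := exists_eq_mkEdge_of_le f e'
      rw [hg] at he he'
      have h1 := hf y x hxy.symm
      have h2 := hstep hxy' hle' (by omega)
      rcases Sym2.mem_iff.1 hw with rfl | rfl <;> rcases Sym2.mem_iff.1 hw' with rfl | rfl
      · omega
      · omega
      · exact ⟨x, w, y', hxy, hxy', rfl, rfl, by omega, by omega, by omega⟩
      · omega
    intro i hi e e' d d' hee' hdd' he he' hd hd'
    obtain ⟨x, y, z, hxy, hyz, rfl, rfl, hx, hy, hz⟩ := key i hi e e' hee' he he'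
    obtain ⟨x', y', z', hxy', hyz', rfl, rfl, hx', hy', hz'⟩ := key i hi d d' hdd' hd hd'
    obtain ⟨rfl, rfl⟩ := huniq i (by omega) x y x' y' hxy hxy' hx hy hx' hy'
    obtain ⟨-, rfl⟩ := huniq (i + 1) (by omega) y z y z' hyz hyz' hy hz hy hz'
    exact ⟨rfl, rfl⟩

theorem HasBridgePath.iterLine {r : ℕ} : ∀ {n : ℕ}, HasBridgePath (n + r) G →
    HasBridgePath n (G.iterLine r) := by
  induction r with
  | zero => exact fun h => h
  | succ r ih =>
    intro n h
    exact (ih (n := n + 1) (by rwa [add_right_comm, add_assoc])).line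

/-! ### Paths with a triangle at one end or at both ends. -/

/-- The path on `m` vertices `0, …, m - 1` with the additional edges `{0, 2}` and
`{n + 2, n + 4}` (as far as these vertices exist). -/
def chordedPath (m n : ℕ) : FinGraph.{u} where
  V := ULift.{u} (Fin m)
  graph := SimpleGraph.fromRel fun v w =>
    (w.down : ℕ) = v.down + 1 ∨ (w.down : ℕ) = v.down + 2 ∧ ((v.down : ℕ) = 0 ∨ (v.down : ℕ) = n + 2)

section ChordedPath

variable {m n : ℕ}

/-- The vertex `i` of a chorded path. -/
def chordedPathVert (n : ℕ) (i : ℕ) (hi : i < m) : (chordedPath.{u} m n).V := ULift.up ⟨i, hi⟩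

theorem exists_eq_chordedPathVert (v : (chordedPath.{u} m n).V) :
    ∃ i, ∃ hi : i < m, v = chordedPathVert n i hi := by
  obtain ⟨i, hi⟩ := v
  exact ⟨i, hi, rfl⟩

theorem chordedPathVert_inj {i j : ℕ} {hi : i < m} {hj : j < m} :
    chordedPathVert.{u} n i hi = chordedPathVert n j hj ↔ i = j :=
  ⟨fun h => congrArg (fun v : (chordedPath.{u} m n).V => (v.down : ℕ)) h, fun h => by subst h; rfl⟩

theorem chordedPath_adj {i j : ℕ} {hi : i < m} {hj : j < m} :
    (chordedPath.{u} m n).graph.Adj (chordedPathVert n i hi) (chordedPathVert n j hj) ↔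
      (j = i + 1 ∨ j = i + 2 ∧ (i = 0 ∨ i = n + 2)) ∨
        (i = j + 1 ∨ i = j + 2 ∧ (j = 0 ∨ j = n + 2)) := by
  simp only [chordedPath, chordedPathVert, fromRel_adj, ne_eq, ULift.up.injEq, Fin.mk.injEq]
  omega

theorem chordedPath_connected (hm : 0 < m) : (chordedPath.{u} m n).graph.Connected := by
  rw [connected_iff_exists_forall_reachable]
  refine ⟨chordedPathVert n 0 hm, fun v => ?_⟩
  obtain ⟨i, hi, rfl⟩ := exists_eq_chordedPathVert v
  induction i with
  | zero => exact Reachable.refl _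
  | succ i ih =>
    exact (ih (by omega)).trans (Adj.reachable (chordedPath_adj.2 (Or.inl (Or.inl rfl))))

theorem hasBridgePath_chordedPath (hm : n + 3 ≤ m) :
    HasBridgePath n (chordedPath.{u} m n) := by
  -- The triangle `0, 1, 2` forms level 0 by truncated subtraction, and all vertices from `n + 2` on
  -- form level `n`.
  let f : (chordedPath.{u} m n).V → ℕ := fun v => min ((v.down : ℕ) - 2) n
  have hf : ∀ i (hi : i < m), f (chordedPathVert n i hi) = min (i - 2) n := fun _ _ => rfl
  refine ⟨f, ?_, ?_, ?_, ?_⟩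
  · intro u v h
    obtain ⟨i, hi, rfl⟩ := exists_eq_chordedPathVert u
    obtain ⟨j, hj, rfl⟩ := exists_eq_chordedPathVert v
    rw [chordedPath_adj] at h
    rw [hf, hf]
    omega
  · intro u v h0 hn h
    obtain ⟨i, hi, rfl⟩ := exists_eq_chordedPathVert u
    obtain ⟨j, hj, rfl⟩ := exists_eq_chordedPathVert v
    rw [hf] at h0 hn
    rw [hf, hf] at h
    rw [chordedPathVert_inj]
    omega
  · intro i hi
    refine ⟨chordedPathVert n (i + 2) (by omega), chordedPathVert n (i + 3) (by omega),
      chordedPath_adj.2 (by omega), ?_, ?_⟩ <;> rw [hf] <;> omega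
  · intro l hl u v u' v' h h' h1 h2 h3 h4
    obtain ⟨i, hi, rfl⟩ := exists_eq_chordedPathVert u
    obtain ⟨j, hj, rfl⟩ := exists_eq_chordedPathVert v
    obtain ⟨i', hi', rfl⟩ := exists_eq_chordedPathVert u'
    obtain ⟨j', hj', rfl⟩ := exists_eq_chordedPathVert v'
    rw [chordedPath_adj] at h h'
    rw [hf] at h1 h2 h3 h4
    rw [chordedPathVert_inj, chordedPathVert_inj]
    have h5 : i = l + 2 ∧ j = l + 3 := by omega
    have h6 : i' = l + 2 ∧ j' = l + 3 := by omega
    omega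

theorem isProlific_chordedPath (hn : 2 ≤ n) (hm : n + 3 ≤ m) :
    (chordedPath.{u} m n).IsProlific := by
  refine isProlific_of_three_le_ncard (chordedPath_connected (by omega))
    (v := chordedPathVert n 2 (by omega)) ?_ ?_
  · refine (Set.two_lt_ncard_iff (Set.toFinite _)).2 ⟨chordedPathVert n 0 (by omega),
      chordedPathVert n 1 (by omega), chordedPathVert n 3 (by omega), chordedPath_adj.2 (by omega),
      chordedPath_adj.2 (by omega), chordedPath_adj.2 (by omega), ?_, ?_, ?_⟩ <;>
    rw [Ne, chordedPathVert_inj] <;> omega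
  · have : Nat.card (chordedPath.{u} m n).V = m := by simp [chordedPath]
    omega

theorem minDegree_chordedPath_eq_one (hn : 1 ≤ n) :
    (chordedPath.{u} (n + 3) n).minDegree = 1 := by
  refine minDegree_eq (v := chordedPathVert n (n + 2) (by omega)) ?_ fun w => ?_
  · rw [← Set.ncard_singleton (chordedPathVert.{u} (m := n + 3) n (n + 1) (by omega))]
    refine Set.ncard_le_ncard fun w hw => ?_
    obtain ⟨i, hi, rfl⟩ := exists_eq_chordedPathVert w
    have := chordedPath_adj.1 hw
    rw [Set.mem_singleton_iff, chordedPathVert_inj]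
    omega
  · obtain ⟨i, hi, rfl⟩ := exists_eq_chordedPathVert w
    rw [Nat.one_le_iff_ne_zero]
    refine Set.ncard_ne_zero_of_mem
      (a := chordedPathVert n (if i = 0 then 1 else i - 1) (by split_ifs <;> omega))
      (chordedPath_adj.2 (by split_ifs <;> omega))

theorem minDegree_chordedPath_eq_two : (chordedPath.{u} (n + 5) n).minDegree = 2 := by
  refine minDegree_eq (v := chordedPathVert n 0 (by omega)) ?_ fun w => ?_
  · have hne : chordedPathVert.{u} (m := n + 5) n 1 (by omega) ≠
        chordedPathVert n 2 (by omega) := by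
      rw [Ne, chordedPathVert_inj]
      omega
    rw [← Set.ncard_pair hne]
    refine Set.ncard_le_ncard fun w hw => ?_
    obtain ⟨i, hi, rfl⟩ := exists_eq_chordedPathVert w
    have := chordedPath_adj.1 hw
    rw [Set.mem_insert_iff, Set.mem_singleton_iff, chordedPathVert_inj, chordedPathVert_inj]
    omega
  · obtain ⟨i, hi, rfl⟩ := exists_eq_chordedPathVert w
    refine (Set.one_lt_ncard_iff (Set.toFinite _)).2
      ⟨chordedPathVert n (if i = 0 then 2 else i - 1) (by split_ifs <;> omega),
        chordedPathVert n (if i = n + 4 then n + 2 else i + 1) (by split_ifs <;> omega),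
        chordedPath_adj.2 (by split_ifs <;> omega), chordedPath_adj.2 (by split_ifs <;> omega), ?_⟩
    rw [Ne, chordedPathVert_inj]
    split_ifs <;> omega

end ChordedPath

/-! ### Unbounded indices and the theorem. -/

theorem le_familyIndex {P : FinGraph.{u} → ℕ} {F : Set FinGraph.{u}} (hG : G ∈ F) :
    ind P G ≤ familyIndex P F :=
  le_iSup₂_of_le G hG le_rfl

/-- The parameter starts at 1 or more and cannot exceed 1 while a bridge remains, so the index grows
with the length of the bridge path. -/
theorem not_isUniversalOver_of_chordedPath_mem {P : FinGraph.{u} → ℕ} {F : Set FinGraph.{u}}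
    (hpos : ∀ G : FinGraph.{u}, G.graph.Connected → Nontrivial G.V → 1 ≤ P G)
    (hle : ∀ (G : FinGraph.{u}) (n : ℕ), HasBridgePath (n + 1) G → P G ≤ 1)
    (hF : ∀ n, 2 ≤ n → ∃ m, n + 3 ≤ m ∧ chordedPath m n ∈ F) : ¬ IsUniversalOver P F := by
  rw [IsUniversalOver, not_not, ENat.eq_top_iff_forall_ge]
  intro N
  obtain ⟨m, hm, hmem⟩ := hF (N + 2) (by omega)
  refine le_trans (le_ind fun r hr => ?_) (le_familyIndex hmem)
  have hnt : Nontrivial (chordedPath.{u} m (N + 2)).V :=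
    ⟨chordedPathVert _ 0 (by omega), chordedPathVert _ 1 (by omega), by
      rw [Ne, chordedPathVert_inj]; omega⟩
  -- Of the `N + 2` bridges, `N + 2 - r` survive `r < N` steps.
  refine (hle _ (N + 1 - r) (HasBridgePath.iterLine ?_)).trans
    (hpos _ (chordedPath_connected (by omega)) hnt)
  rw [show N + 1 - r + 1 + r = N + 2 by omega]
  exact hasBridgePath_chordedPath hm

theorem not_isUniversalOver_of_minDegree {F : Set FinGraph.{u}} {d : ℕ} (hd : d = 1 ∨ d = 2)
    (hF : {G : FinGraph.{u} | G.IsProlific ∧ G.minDegree = d} ⊆ F) :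
    ¬ IsUniversalOver vertexConn F ∧ ¬ IsUniversalOver edgeConn F := by
  have hmem : ∀ n, 2 ≤ n → ∃ m, n + 3 ≤ m ∧ chordedPath.{u} m n ∈ F := by
    intro n hn
    rcases hd with rfl | rfl
    · exact ⟨n + 3, le_rfl,
        hF ⟨isProlific_chordedPath hn le_rfl, minDegree_chordedPath_eq_one (by omega)⟩⟩
    · exact ⟨n + 5, by omega,
        hF ⟨isProlific_chordedPath hn (by omega), minDegree_chordedPath_eq_two⟩⟩
  exact ⟨not_isUniversalOver_of_chordedPath_mem (fun _ h _ => one_le_vertexConn h)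
      (fun _ _ h => h.vertexConn_le_one) hmem,
    not_isUniversalOver_of_chordedPath_mem (fun _ h _ => one_le_edgeConn h)
      (fun _ _ h => h.edgeConn_le_one) hmem⟩

end FinGraph

theorem familyIndex_vertexConn_minDegree_ge_three :
    FinGraph.familyIndex FinGraph.vertexConn
      {G : FinGraph.{u} | G.IsProlific ∧ 3 ≤ G.minDegree} = 2 := by
  refine le_antisymm (iSup₂_le fun G hG => FinGraph.ind_vertexConn_le_two hG.1.1 hG.2) ?_
  rw [← FinGraph.ind_vertexConn_chartrandHarary.{u} (k := 3) (d := 3) (by norm_num) le_rfl le_rfl]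
  exact FinGraph.le_familyIndex
    ⟨FinGraph.isProlific_chartrandHarary (by norm_num) le_rfl le_rfl,
      (FinGraph.minDegree_chartrandHarary le_rfl).ge⟩

theorem theoremL :
    -- every prolific graph with `δ ≥ 3` has `ind(κ, G) ≤ 2`
    (∀ G : FinGraph.{u}, G.IsProlific → 3 ≤ G.minDegree → FinGraph.ind FinGraph.vertexConn G ≤ 2) ∧
    -- for all `δ = d ≥ 3` and `1 ≤ k ≤ d`, the Chartrand-Harary graph with `κ = λ = k` attains it
    (∀ k d : ℕ, 1 ≤ k → k ≤ d → 3 ≤ d →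
      (FinGraph.chartrandHarary.{u} k k d).IsProlific ∧
      (FinGraph.chartrandHarary.{u} k k d).vertexConn = k ∧
      (FinGraph.chartrandHarary.{u} k k d).edgeConn = k ∧
      (FinGraph.chartrandHarary.{u} k k d).minDegree = d ∧
      FinGraph.ind FinGraph.vertexConn (FinGraph.chartrandHarary.{u} k k d) = 2) ∧
    -- hence `k(κ, F) = 2` for the family `F` of prolific graphs with `δ ≥ 3`
    FinGraph.familyIndex FinGraph.vertexConn {G : FinGraph.{u} | G.IsProlific ∧ 3 ≤ G.minDegree} = 2 ∧
    -- for `δ ≤ 2`, and even for `δ = 1` and for `δ = 2` separately, `κ` and `λ` are non-universal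
    ¬ FinGraph.IsUniversalOver FinGraph.vertexConn {G : FinGraph.{u} | G.IsProlific ∧ G.minDegree ≤ 2} ∧
    ¬ FinGraph.IsUniversalOver FinGraph.edgeConn {G : FinGraph.{u} | G.IsProlific ∧ G.minDegree ≤ 2} ∧
    (∀ d : ℕ, d = 1 ∨ d = 2 →
      ¬ FinGraph.IsUniversalOver FinGraph.vertexConn {G : FinGraph.{u} | G.IsProlific ∧ G.minDegree = d} ∧
      ¬ FinGraph.IsUniversalOver FinGraph.edgeConn {G : FinGraph.{u} | G.IsProlific ∧ G.minDegree = d}) := by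
  refine ⟨fun G hG hδ => FinGraph.ind_vertexConn_le_two hG.1 hδ, fun k d hk hkd hd =>
    ⟨FinGraph.isProlific_chartrandHarary hk hkd hd, FinGraph.vertexConn_chartrandHarary hkd,
      FinGraph.edgeConn_chartrandHarary hkd, FinGraph.minDegree_chartrandHarary hkd,
      FinGraph.ind_vertexConn_chartrandHarary hk hkd hd⟩,
    familyIndex_vertexConn_minDegree_ge_three, ?_, ?_, fun d hd =>
    FinGraph.not_isUniversalOver_of_minDegree hd subset_rfl⟩
  · exact (FinGraph.not_isUniversalOver_of_minDegree (Or.inl rfl)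
      fun G (hG : G.IsProlific ∧ G.minDegree = 1) => And.intro hG.1 (by omega)).1
  · exact (FinGraph.not_isUniversalOver_of_minDegree (Or.inl rfl)
      fun G (hG : G.IsProlific ∧ G.minDegree = 1) => And.intro hG.1 (by omega)).2
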